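/- Let $H$ be a complex Hilbert space with an orthonormal basis $\{|n\rangle : n=0,1,2,\dots\}$, and let $a=\sum_{n\ge 0}\sqrt{n+1}\,|n\rangle\langle n+1|$ and $a^*=\sum_{n\ge 0}\sqrt{n+1}\,|n+1\rangle\langle n|$ be the lowering and raising operators. For $z\in\mathbb{C}$ let $D(z)=e^{za^*-\overline{z}a}$ be the (unitary) shift operator, that is, the bounded operator with $D(z)|n\rangle=\sum_{k\ge 0}\frac{1}{k!}(za^*-\overline{z}a)^k|n\rangle$ for all $n$. A diagonal state is an operator $T=\sum_{n\ge 0}\lambda_n|n\rangle\langle n|$ with $\lambda_n\ge 0$ for all $n$ and $\sum_{n\ge 0}\lambda_n=1$. The phase observable generated by a diagonal state $T$ is the operator-valued map $\mathsf{E}_T$ on the Borel sets $X$ of the unit circle $\mathbb{T}=\{t\in\mathbb{C}:|t|=1\}$ whose value $\mathsf{E}_T(X)$ is the bounded operator on $H$ given in the weak sense by $$\mathsf{E}_T(X)=\frac1\pi\int_{\arg X}\int_0^\infty D(re^{i\theta})\,T\,D(re^{i\theta})^*\,r\,dr\,d\theta ,$$ i.e. $\langle\varphi,\mathsf{E}_T(X)\psi\rangle=\frac1\pi\int_{\arg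 X}\int_0^\infty\langle\varphi,D(re^{i\theta})TD(re^{i\theta})^*\psi\rangle\,r\,dr\,d\theta$ for all $\varphi,\psi\in H$, where $\arg X=\{\theta\in[0,2\pi): e^{i\theta}\in X\}$. Proposition. Let $T$ and $T'$ be diagonal states. If $\mathsf{E}_T=\mathsf{E}_{T'}$, i.e. $\mathsf{E}_T(X)=\mathsf{E}_{T'}(X)$ for every Borel set $X\subseteq\mathbb{T}$, then $T=T'$. -/

import Mathlib

open scoped ComplexConjugate

namespace PhaseSpace

noncomputable section

/-! Finite linear combinations of the number states are coded as finitely supported sequences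
`ℕ →₀ ℂ`; on them the ladder operators and all their products are everywhere defined. -/

/-- The raising operator `a*`, with `a* |n⟩ = √(n+1) |n+1⟩`. -/
def raising : (ℕ →₀ ℂ) →ₗ[ℂ] (ℕ →₀ ℂ) :=
  Finsupp.linearCombination ℂ fun n => Finsupp.single (n + 1) ((Real.sqrt (n + 1) : ℝ) : ℂ)

/-- The lowering operator `a`, with `a |n⟩ = √n |n-1⟩` (and so `a |0⟩ = 0`). -/
def lowering : (ℕ →₀ ℂ) →ₗ[ℂ] (ℕ →₀ ℂ) :=
  Finsupp.linearCombination ℂ fun n => Finsupp.single (n - 1) ((Real.sqrt n : ℝ) : ℂ)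

/-- The operator `z a* - conj(z) a`. -/
def shiftGen (z : ℂ) : Module.End ℂ (ℕ →₀ ℂ) := z • raising - conj z • lowering

lemma shiftGen_single (z : ℂ) (n : ℕ) : shiftGen z (Finsupp.single n 1) =
    (z * (Real.sqrt (n + 1) : ℝ)) • Finsupp.single (n + 1) (1 : ℂ)
      - (conj z * (Real.sqrt n : ℝ)) • Finsupp.single (n - 1) (1 : ℂ) := by
  simp [shiftGen, raising, lowering]

variable {H : Type*} [NormedAddCommGroup H] [InnerProductSpace ℂ H]

/-- The finite linear combination `∑ f n |n⟩`, where `|n⟩ = b n`. -/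
def embed (b : HilbertBasis ℕ ℂ H) : (ℕ →₀ ℂ) →ₗ[ℂ] H := Finsupp.linearCombination ℂ b

/-- The `k`-th term `(z a* - conj(z) a)^k |n⟩ / k!` of the exponential series at a number state. -/
def expTerm (b : HilbertBasis ℕ ℂ H) (z : ℂ) (n k : ℕ) : H :=
  ((k.factorial : ℂ)⁻¹) • embed b ((shiftGen z ^ k) (Finsupp.single n 1))

lemma inner_embed_single (b : HilbertBasis ℕ ℂ H) (m n : ℕ) :
    inner ℂ (embed b (Finsupp.single m 1)) (embed b (Finsupp.single n 1))
      = if m = n then (1 : ℂ) else 0 := by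
  simpa [embed] using orthonormal_iff_ite.1 b.orthonormal m n

lemma shiftGen_skew_single (b : HilbertBasis ℕ ℂ H) (z : ℂ) (m n : ℕ) :
    inner ℂ (embed b (shiftGen z (Finsupp.single m 1))) (embed b (Finsupp.single n 1))
      = -inner ℂ (embed b (Finsupp.single m 1)) (embed b (shiftGen z (Finsupp.single n 1))) := by
  simp only [shiftGen_single, map_sub, map_smul, inner_sub_left, inner_sub_right, inner_smul_left,
    inner_smul_right, inner_embed_single]
  rcases m with _ | m <;> rcases n with _ | n <;> simp <;>
    split_ifs <;> first | omega | (subst_vars; simp)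

lemma shiftGen_skew (b : HilbertBasis ℕ ℂ H) (z : ℂ) (f g : ℕ →₀ ℂ) :
    inner ℂ (embed b (shiftGen z f)) (embed b g)
      = -inner ℂ (embed b f) (embed b (shiftGen z g)) := by
  induction f using Finsupp.induction_linear with
  | zero => simp
  | add f₁ f₂ h₁ h₂ => simp only [map_add, inner_add_left, h₁, h₂]; ring
  | single m c =>
    induction g using Finsupp.induction_linear with
    | zero => simp
    | add f₁ f₂ h₁ h₂ => simp only [map_add, inner_add_right, h₁, h₂]; ring
    | single n d =>
      have hc : Finsupp.single m c = c • Finsupp.single m (1 : ℂ) := by simp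
      have hd : Finsupp.single n d = d • Finsupp.single n (1 : ℂ) := by simp
      rw [hc, hd]
      simp only [map_smul, inner_smul_left, inner_smul_right, shiftGen_skew_single]
      ring

lemma shiftGen_pow_skew (b : HilbertBasis ℕ ℂ H) (z : ℂ) (k : ℕ) (f g : ℕ →₀ ℂ) :
    inner ℂ (embed b ((shiftGen z ^ k) f)) (embed b g)
      = (-1) ^ k * inner ℂ (embed b f) (embed b ((shiftGen z ^ k) g)) := by
  induction k generalizing f with
  | zero => simp
  | succ k ih =>
    rw [pow_succ, Module.End.mul_apply, ih, shiftGen_skew, ← Module.End.mul_apply, ← pow_succ',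
      pow_succ (-1 : ℂ), pow_succ]
    ring

lemma norm_embed_pow_le (b : HilbertBasis ℕ ℂ H) (z : ℂ) (k n : ℕ) :
    ‖embed b ((shiftGen z ^ k) (Finsupp.single n 1))‖
      ≤ (2 * ‖z‖) ^ k * Real.sqrt ((n + 1).ascFactorial k) := by
  induction k generalizing n with
  | zero => simp [embed, b.orthonormal.1 n]
  | succ k ih =>
    have e : ((n + 1 : ℕ).ascFactorial (k + 1) : ℝ) = (n + 1) * ((n + 2).ascFactorial k : ℝ) := by
      have := Nat.succ_ascFactorial (n + 1) k
      rw [Nat.ascFactorial_succ]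
      have h2 : (n + 1 : ℕ) * ((n + 2).ascFactorial k) = (n + 1 + k) * (n + 1).ascFactorial k := this
      exact_mod_cast h2.symm
    have h1 : Real.sqrt (n + 1) * Real.sqrt ((n + 2).ascFactorial k)
        = Real.sqrt ((n + 1).ascFactorial (k + 1)) := by
      rw [e, Real.sqrt_mul (by positivity)]
    have h2 : Real.sqrt n * Real.sqrt ((n - 1 + 1).ascFactorial k)
        ≤ Real.sqrt ((n + 1).ascFactorial (k + 1)) := by
      rw [← Real.sqrt_mul (by positivity), e]
      apply Real.sqrt_le_sqrt
      rcases n with _ | n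
      · simp
      · have : (n + 1).ascFactorial k ≤ (n + 1 + 2).ascFactorial k :=
          Nat.ascFactorial_le k (by omega)
        have h3 : ((n + 1).ascFactorial k : ℝ) ≤ ((n + 1 + 2).ascFactorial k : ℝ) := by
          exact_mod_cast this
        simp only [Nat.add_sub_cancel]
        gcongr
        linarith
    rw [pow_succ, Module.End.mul_apply, shiftGen_single, map_sub, map_sub, map_smul, map_smul,
      map_smul, map_smul]
    refine (norm_sub_le _ _).trans ?_
    rw [norm_smul, norm_smul, norm_mul, norm_mul, RCLike.norm_conj, Complex.norm_real,
      Complex.norm_real, Real.norm_of_nonneg (Real.sqrt_nonneg _),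
      Real.norm_of_nonneg (Real.sqrt_nonneg _)]
    calc _ ≤ ‖z‖ * Real.sqrt (n + 1) * ((2 * ‖z‖) ^ k * Real.sqrt ((n + 2).ascFactorial k))
          + ‖z‖ * Real.sqrt n * ((2 * ‖z‖) ^ k * Real.sqrt ((n - 1 + 1).ascFactorial k)) := by
          gcongr
          · exact ih (n + 1)
          · exact ih (n - 1)
      _ = ‖z‖ * (2 * ‖z‖) ^ k * (Real.sqrt (n + 1) * Real.sqrt ((n + 2).ascFactorial k))
          + ‖z‖ * (2 * ‖z‖) ^ k * (Real.sqrt n * Real.sqrt ((n - 1 + 1).ascFactorial k)) := by ring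
      _ ≤ ‖z‖ * (2 * ‖z‖) ^ k * Real.sqrt ((n + 1).ascFactorial (k + 1))
          + ‖z‖ * (2 * ‖z‖) ^ k * Real.sqrt ((n + 1).ascFactorial (k + 1)) := by
          rw [h1]; gcongr
      _ = _ := by ring

/-- Number states are analytic vectors: the exponential series converges absolutely. -/
lemma summable_norm_expTerm (b : HilbertBasis ℕ ℂ H) (z : ℂ) (n : ℕ) :
    Summable fun k => ‖expTerm b z n k‖ := by
  have hg : Summable fun k : ℕ =>
      (1 / 4 : ℝ) ^ k + 2 ^ n * ((32 * ‖z‖ ^ 2) ^ k / k.factorial) :=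
    (summable_geometric_of_lt_one (by norm_num) (by norm_num)).add
      ((Real.summable_pow_div_factorial _).mul_left _)
  refine Summable.of_nonneg_of_le (fun _ => norm_nonneg _) (fun k => ?_) hg
  have hk : (0 : ℝ) < k.factorial := by positivity
  have hasc : ((n + 1).ascFactorial k : ℝ) ≤ k.factorial * 2 ^ (n + k) := by
    have h : (n + 1).ascFactorial k ≤ k.factorial * 2 ^ (n + k) := by
      rw [Nat.ascFactorial_eq_factorial_mul_choose]
      exact Nat.mul_le_mul_left _ (Nat.choose_le_two_pow _ _)
    exact_mod_cast h
  set S := Real.sqrt ((n + 1).ascFactorial k) with hS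
  have hS2 : S ^ 2 = (n + 1).ascFactorial k := Real.sq_sqrt (by positivity)
  have h1 : ‖expTerm b z n k‖ ≤ (2 * ‖z‖) ^ k * S / k.factorial := by
    rw [expTerm, norm_smul, norm_inv, Complex.norm_natCast, div_eq_inv_mul]
    gcongr
    exact norm_embed_pow_le b z k n
  refine h1.trans ?_
  set x := (4 * ‖z‖) ^ k * S / k.factorial with hx
  have h2 : (2 * ‖z‖) ^ k * S / k.factorial = (1 / 2) ^ k * x := by
    rw [hx, show (4 * ‖z‖) = 2 * (2 * ‖z‖) by ring, mul_pow 2 (2 * ‖z‖)]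
    have : (1 / 2 : ℝ) ^ k * 2 ^ k = 1 := by rw [← mul_pow]; norm_num
    linear_combination (-((2 * ‖z‖) ^ k * S / k.factorial)) * this
  have h3 : x ^ 2 ≤ 2 ^ n * ((32 * ‖z‖ ^ 2) ^ k / k.factorial) := by
    have e1 : x ^ 2 = (16 * ‖z‖ ^ 2) ^ k * ((n + 1).ascFactorial k / (k.factorial * k.factorial)) := by
      rw [hx, div_pow, mul_pow, hS2, ← pow_mul, mul_comm k 2, pow_mul]
      ring
    have e2 : 2 ^ n * ((32 * ‖z‖ ^ 2) ^ k / k.factorial)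
        = (16 * ‖z‖ ^ 2) ^ k * ((k.factorial * 2 ^ (n + k)) / (k.factorial * k.factorial)) := by
      rw [show 32 * ‖z‖ ^ 2 = 2 * (16 * ‖z‖ ^ 2) by ring, mul_pow 2 (16 * ‖z‖ ^ 2), pow_add]
      field_simp
    rw [e1, e2]
    gcongr
  have h4 : ((1 / 2 : ℝ) ^ k) ^ 2 = (1 / 4) ^ k := by
    rw [← pow_mul, mul_comm, pow_mul]; norm_num
  rw [h2]
  nlinarith [sq_nonneg ((1 / 2 : ℝ) ^ k - x), sq_nonneg ((1 / 2 : ℝ) ^ k + x), sq_nonneg x]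

lemma sum_antidiagonal_inner_expTerm (b : HilbertBasis ℕ ℂ H) (z : ℂ) (m n N : ℕ) :
    ∑ p ∈ Finset.HasAntidiagonal.antidiagonal N, inner ℂ (expTerm b z m p.1) (expTerm b z n p.2)
      = if N = 0 then (if m = n then 1 else 0) else 0 := by
  have key : ∀ p ∈ Finset.HasAntidiagonal.antidiagonal N, inner ℂ (expTerm b z m p.1)
        (expTerm b z n p.2) = ((N.factorial : ℂ)⁻¹ * inner ℂ (embed b (Finsupp.single m 1))
          (embed b ((shiftGen z ^ N) (Finsupp.single n 1))))
        * ((-1) ^ p.1 * 1 ^ p.2 * (N.choose p.1 : ℂ)) := by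
    intro p hp
    rw [Finset.HasAntidiagonal.mem_antidiagonal] at hp
    have hc : (N.choose p.1 : ℂ) * (p.1.factorial * p.2.factorial) = N.factorial := by
      have := Nat.choose_mul_factorial_mul_factorial (show p.1 ≤ N by omega)
      rw [show N - p.1 = p.2 by omega] at this
      rw [← mul_assoc]
      exact_mod_cast this
    have h1 : (p.1.factorial : ℂ) ≠ 0 := by exact_mod_cast p.1.factorial_ne_zero
    have h2 : (p.2.factorial : ℂ) ≠ 0 := by exact_mod_cast p.2.factorial_ne_zero
    have h3 : (N.choose p.1 : ℂ) ≠ 0 := by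
      exact_mod_cast (Nat.choose_pos (by omega)).ne'
    rw [expTerm, expTerm, inner_smul_left, inner_smul_right, shiftGen_pow_skew,
      ← Module.End.mul_apply, ← pow_add, hp, ← hc]
    simp only [map_inv₀, map_natCast, one_pow, mul_one]
    field_simp
  rw [Finset.sum_congr rfl key, ← Finset.mul_sum]
  have hbin : ∑ p ∈ Finset.HasAntidiagonal.antidiagonal N,
      ((-1 : ℂ) ^ p.1 * 1 ^ p.2 * (N.choose p.1 : ℂ))
      = (-1 + 1) ^ N := by
    rw [(Commute.all (-1 : ℂ) 1).add_pow']
    exact Finset.sum_congr rfl fun p _ => by rw [nsmul_eq_mul]; ring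
  rw [hbin]
  rcases N with _ | N
  · simpa using inner_embed_single b m n
  · simp

variable [CompleteSpace H]

/-- The exponential series maps the number states to an orthonormal family. -/
lemma orthonormal_tsum_expTerm (b : HilbertBasis ℕ ℂ H) (z : ℂ) :
    Orthonormal ℂ fun n => ∑' k, expTerm b z n k := by
  rw [orthonormal_iff_ite]
  intro m n
  have hm := summable_norm_expTerm b z m
  have hn := summable_norm_expTerm b z n
  have hprod : Summable fun p : ℕ × ℕ => inner ℂ (expTerm b z m p.1) (expTerm b z n p.2) := by
    refine Summable.of_norm_bounded
      (hm.mul_of_nonneg hn (fun _ => norm_nonneg _) (fun _ => norm_nonneg _)) fun p => ?_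
    exact norm_inner_le_norm _ _
  have e1 : inner ℂ (∑' k, expTerm b z m k) (∑' k, expTerm b z n k)
      = ∑' p : ℕ × ℕ, inner ℂ (expTerm b z m p.1) (expTerm b z n p.2) := by
    rw [hprod.tsum_prod, ← inner_conj_symm]
    have h1 := (innerSL ℂ (∑' k, expTerm b z n k)).map_tsum (f := expTerm b z m) hm.of_norm
    simp only [innerSL_apply_apply] at h1
    rw [h1, Complex.conj_tsum]
    refine tsum_congr fun j => ?_
    rw [inner_conj_symm]
    have h2 := (innerSL ℂ (expTerm b z m j)).map_tsum (f := expTerm b z n) hn.of_norm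
    simpa only [innerSL_apply_apply] using h2
  have hs : Summable fun c : (Σ N : ℕ, Finset.HasAntidiagonal.antidiagonal N) =>
      inner ℂ (expTerm b z m (Finset.HasAntidiagonal.sigmaAntidiagonalEquivProd c).1)
        (expTerm b z n (Finset.HasAntidiagonal.sigmaAntidiagonalEquivProd c).2) :=
    (Finset.HasAntidiagonal.sigmaAntidiagonalEquivProd.summable_iff).2 hprod
  rw [e1, ← Finset.HasAntidiagonal.sigmaAntidiagonalEquivProd.tsum_eq, hs.tsum_sigma'
      (fun N => (hasSum_fintype _).summable)]
  have e2 : ∀ N : ℕ, ∑' c : Finset.HasAntidiagonal.antidiagonal N,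
      inner ℂ (expTerm b z m (Finset.HasAntidiagonal.sigmaAntidiagonalEquivProd ⟨N, c⟩).1)
        (expTerm b z n (Finset.HasAntidiagonal.sigmaAntidiagonalEquivProd ⟨N, c⟩).2)
      = if N = 0 then (if m = n then (1 : ℂ) else 0) else 0 := by
    intro N
    rw [← sum_antidiagonal_inner_expTerm b z m n N, tsum_fintype]
    exact Finset.sum_coe_sort (Finset.HasAntidiagonal.antidiagonal N)
      fun p => inner ℂ (expTerm b z m p.1) (expTerm b z n p.2)
  rw [tsum_congr e2, tsum_ite_eq]

lemma exists_shift (b : HilbertBasis ℕ ℂ H) (z : ℂ) :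
    ∃ D : H →L[ℂ] H, ∀ n, HasSum (expTerm b z n) (D (b n)) := by
  have ho := orthonormal_tsum_expTerm b z
  refine ⟨ho.orthogonalFamily.linearIsometry.toContinuousLinearMap ∘L
    (b.repr.toContinuousLinearEquiv : H →L[ℂ] _), fun n => ?_⟩
  have : (ho.orthogonalFamily.linearIsometry.toContinuousLinearMap ∘L
      (b.repr.toContinuousLinearEquiv : H →L[ℂ] _)) (b n) = ∑' k, expTerm b z n k := by
    simp [HilbertBasis.repr_self]
  rw [this]
  exact (summable_norm_expTerm b z n).of_norm.hasSum

/-- The shift operator `D(z) = exp(z a* - conj(z) a)`: the bounded operator which is given on every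
number state by the exponential series. -/
def shift (b : HilbertBasis ℕ ℂ H) (z : ℂ) : H →L[ℂ] H := (exists_shift b z).choose

lemma hasSum_shift (b : HilbertBasis ℕ ℂ H) (z : ℂ) (n : ℕ) :
    HasSum (expTerm b z n) (shift b z (b n)) := (exists_shift b z).choose_spec n

/-- The diagonal states `T = ∑ λₙ |n⟩⟨n|` with `λₙ ≥ 0` and `∑ λₙ = 1`. -/
def diagonalStates (b : HilbertBasis ℕ ℂ H) : Set (H →L[ℂ] H) :=
  {T | ∃ l : ℕ → ℝ, (∀ n, 0 ≤ l n) ∧ HasSum l 1 ∧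
    HasSum (fun n => (l n : ℂ) • InnerProductSpace.rankOne ℂ (b n) (b n)) T}

/-- The set `arg X ⊆ [0, 2π)` of the arguments of the points of `X`. -/
def args (X : Set Circle) : Set ℝ := {θ | θ ∈ Set.Ico 0 (2 * Real.pi) ∧ Circle.exp θ ∈ X}

/-- The sesquilinear form
`(1/π) ∫_{arg X} ∫_0^∞ ⟨φ, D(r e^{iθ}) T D(r e^{iθ})* ψ⟩ r dr dθ`. -/
def phaseForm (b : HilbertBasis ℕ ℂ H) (T : H →L[ℂ] H) (X : Set Circle) (φ ψ : H) : ℂ :=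
  (1 / Real.pi : ℂ) * ∫ θ in args X, ∫ r in Set.Ioi (0 : ℝ),
    inner ℂ φ ((shift b (r * Complex.exp (θ * Complex.I)) ∘L T ∘L
      (shift b (r * Complex.exp (θ * Complex.I))).adjoint) ψ) * (r : ℂ)

open Classical in
/-- The phase observable generated by `T`: `E_T(X)` is the bounded operator whose sesquilinear form
is `phaseForm b T X` (the operator integral in the weak sense). -/
def phaseObservable (b : HilbertBasis ℕ ℂ H) (T : H →L[ℂ] H) (X : Set Circle) : H →L[ℂ] H :=
  if h : ∃ E : H →L[ℂ] H, ∀ φ ψ : H, inner ℂ φ (E ψ) = phaseForm b T X φ ψ then h.choose else 0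

end

end PhaseSpace

namespace PhaseSpace

noncomputable section

open MeasureTheory Filter Topology

/-! The matrix elements of the shift operator have the form `⟨m| D(r e^{iθ}) |k⟩ = e^{i(m-k)θ}
R_{mk}(r)` with `R_{mk}` real: a polynomial times `e^{-r²/2}`. In `⟨m| D T D* |n⟩` the dependence on
`k` therefore drops out of the phase, and the form of `E_T(X)` at a pair of number states is the
integral of `e^{i(m-n)θ}` over `arg X` times a linear functional of the weights `λ`. For `m = 0`, `n
= 2(d+1)` that functional can be computed. Gaussian moments turn the radial integral into the
coefficient of `x^k` in `(1-x)^n (1-x)^{-(d+2)} = (1-x)^d` (`integral_radial_zero_mul_radial`), so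
up to a nonzero constant it is `∑ (-1)^k C(d,k) λ_k`. On an arc of length `π/n` the angular factor
is nonzero, so `E_T` determines this binomial transform for every `d`. The transform is triangular
with diagonal entries `±1`, hence determines `λ` and `T` (`eq_of_binomial_transform_eq`).

The other burden is analytic: `phaseObservable` carries information only if the weak integral does
define a bounded operator. This rests on the orthogonality relations over phase space
(`integral_polarElement`), which with Fatou and Bessel make all amplitudes square integrable
(`lintegral_amplitude_sq_le`); summing against the weights then bounds the form
(`IsDiagonal.inner_phaseObservable`). -/

/-! ### Ladder operators and commutation relations on finite sequences -/

lemma raising_single (n : ℕ) : raising (Finsupp.single n 1) =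
    Finsupp.single (n + 1) ((Real.sqrt (n + 1) : ℝ) : ℂ) := by
  simp [raising]

lemma lowering_single (n : ℕ) : lowering (Finsupp.single n 1) =
    Finsupp.single (n - 1) ((Real.sqrt n : ℝ) : ℂ) := by
  simp [lowering]

lemma single_eq_smul (n : ℕ) (c : ℂ) : Finsupp.single n c = c • Finsupp.single n (1 : ℂ) := by
  simp

lemma end_ext {f g : Module.End ℂ (ℕ →₀ ℂ)}
    (h : ∀ n, f (Finsupp.single n 1) = g (Finsupp.single n 1)) : f = g := by
  apply Finsupp.lhom_ext
  intro n c
  rw [single_eq_smul, map_smul, map_smul, h]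

lemma sqrt_mul_sqrt_natCast (n : ℕ) :
    ((Real.sqrt n : ℝ) : ℂ) * ((Real.sqrt n : ℝ) : ℂ) = n := by
  rw [← Complex.ofReal_mul, Real.mul_self_sqrt (by positivity)]
  simp

/-- The canonical commutation relation `a a* = a* a + 1`. -/
lemma lowering_mul_raising :
    (lowering * raising : Module.End ℂ (ℕ →₀ ℂ)) = raising * lowering + 1 := by
  apply end_ext
  intro n
  simp only [Module.End.mul_apply, LinearMap.add_apply, Module.End.one_apply, raising_single,
    lowering_single]
  rw [single_eq_smul, single_eq_smul (n - 1), map_smul, map_smul, raising_single, lowering_single]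
  simp only [Finsupp.smul_single, smul_eq_mul]
  have h := sqrt_mul_sqrt_natCast (n + 1)
  push_cast at h
  rcases n with _ | n
  · simp
  · have h' := sqrt_mul_sqrt_natCast (n + 1)
    push_cast at h' h ⊢
    rw [h, h', ← Finsupp.single_add]

lemma lowering_mul_shiftGen (z : ℂ) :
    (lowering * shiftGen z : Module.End ℂ (ℕ →₀ ℂ)) = shiftGen z * lowering + z • 1 := by
  have h f : lowering (raising f) = raising (lowering f) + f :=
    LinearMap.congr_fun lowering_mul_raising f
  apply end_ext
  intro n
  simp only [shiftGen, Module.End.mul_apply, LinearMap.sub_apply, LinearMap.smul_apply,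
    LinearMap.add_apply, map_sub, map_smul, Module.End.one_apply, h]
  module

lemma raising_mul_shiftGen (z : ℂ) :
    (raising * shiftGen z : Module.End ℂ (ℕ →₀ ℂ)) = shiftGen z * raising + conj z • 1 := by
  have h f : lowering (raising f) = raising (lowering f) + f :=
    LinearMap.congr_fun lowering_mul_raising f
  apply end_ext
  intro n
  simp only [shiftGen, Module.End.mul_apply, LinearMap.sub_apply, LinearMap.smul_apply,
    LinearMap.add_apply, map_sub, map_smul, Module.End.one_apply, h]
  module

/-- A scalar commutator makes `[x, ·]` act on powers of `y` as `c` times the derivative. Used on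
each term of the exponential series, it replaces commuting an unbounded operator past `D(z)`. -/
lemma mul_pow_succ_of_mul_eq {x y : Module.End ℂ (ℕ →₀ ℂ)} {c : ℂ} (h : x * y = y * x + c • 1)
    (j : ℕ) : x * y ^ (j + 1) = y ^ (j + 1) * x + ((j + 1 : ℂ) * c) • y ^ j := by
  induction j with
  | zero => simpa using h
  | succ j ih =>
    rw [pow_succ, ← mul_assoc, ih, add_mul, mul_assoc, h, mul_add, ← mul_assoc, smul_mul_assoc,
      ← pow_succ, ← pow_succ, mul_smul_comm, mul_one, add_assoc, ← add_smul]
    congr 2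
    push_cast
    ring

lemma lowering_apply (f : ℕ →₀ ℂ) (m : ℕ) :
    lowering f m = ((Real.sqrt (m + 1) : ℝ) : ℂ) * f (m + 1) := by
  induction f using Finsupp.induction_linear with
  | zero => simp
  | add f g hf hg => simp [hf, hg, mul_add]
  | single n c =>
    rw [single_eq_smul, map_smul, lowering_single]
    rcases n with _ | n
    · simp
    · simp only [Finsupp.smul_apply, Finsupp.single_apply, smul_eq_mul]
      by_cases h : n = m
      · subst h; simp [mul_comm]
      · simp [h]

lemma raising_apply_zero (f : ℕ →₀ ℂ) : raising f 0 = 0 := by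
  induction f using Finsupp.induction_linear with
  | zero => simp
  | add f g hf hg => simp [hf, hg]
  | single n c => rw [single_eq_smul, map_smul, raising_single]; simp

/-! ### Matrix elements of the shift operator -/

variable {H : Type*} [NormedAddCommGroup H] [InnerProductSpace ℂ H]

lemma inner_embed (b : HilbertBasis ℕ ℂ H) (m : ℕ) (f : ℕ →₀ ℂ) :
    inner ℂ (b m) (embed b f) = f m := by
  induction f using Finsupp.induction_linear with
  | zero => simp
  | add f g hf hg => simp [hf, hg]
  | single n c =>
    have := inner_embed_single b m n
    rw [single_eq_smul, map_smul, inner_smul_right]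
    simp only [embed, Finsupp.linearCombination_single, one_smul] at this ⊢
    rw [this]
    by_cases h : n = m
    · simp [h]
    · simp [Ne.symm h]

/-- The `j`-th term of the series of the matrix element `⟨m| D(z) |k⟩`. -/
def matrixTerm (z : ℂ) (m k j : ℕ) : ℂ :=
  (j.factorial : ℂ)⁻¹ * (shiftGen z ^ j) (Finsupp.single k 1) m

variable [CompleteSpace H]

lemma hasSum_matrixTerm (b : HilbertBasis ℕ ℂ H) (z : ℂ) (m k : ℕ) :
    HasSum (matrixTerm z m k) (inner ℂ (b m) (shift b z (b k))) := by
  have h := (hasSum_shift b z k).mapL (innerSL ℂ (b m))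
  simp only [innerSL_apply_apply] at h
  refine (congrArg (HasSum · _) (funext fun j => ?_)).mp h
  simp only [expTerm, inner_smul_right, inner_embed, matrixTerm]

/-- The factor `j + 1` from the commutator cancels against `(j + 1)!`, so `u` is `c` times the
matrix series moved by one index. -/
lemma hasSum_shifted_matrixTerm {c : ℂ} {z : ℂ} {m k : ℕ} {s : ℂ} (h : HasSum (matrixTerm z m k) s)
    {u : ℕ → ℂ} (h0 : u 0 = 0)
    (hu : ∀ j, u (j + 1) = ((j + 1).factorial : ℂ)⁻¹ *
      (((j + 1 : ℂ) * c) * (shiftGen z ^ j) (Finsupp.single k 1) m)) :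
    HasSum u (c * s) := by
  rw [← hasSum_nat_add_iff' 1]
  simp only [Finset.sum_range_one, h0, sub_zero]
  refine (congrArg (HasSum · _) (funext fun j => ?_)).mpr (h.mul_left c)
  rw [hu, matrixTerm, Nat.factorial_succ]
  have : (j.factorial : ℂ) ≠ 0 := by exact_mod_cast j.factorial_ne_zero
  have h2 : (j + 1 : ℂ) ≠ 0 := by exact_mod_cast j.succ_ne_zero
  push_cast
  field_simp

/-- The recursion of the matrix elements that comes from `a D(z) = D(z) (a + z)`. -/
lemma matrixElement_succ (b : HilbertBasis ℕ ℂ H) (z : ℂ) (m k : ℕ) :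
    ((Real.sqrt (m + 1) : ℝ) : ℂ) * inner ℂ (b (m + 1)) (shift b z (b k))
      = ((Real.sqrt k : ℝ) : ℂ) * inner ℂ (b m) (shift b z (b (k - 1)))
        + z * inner ℂ (b m) (shift b z (b k)) := by
  have h1 := (hasSum_matrixTerm b z (m + 1) k).mul_left ((Real.sqrt (m + 1) : ℝ) : ℂ)
  have h2 := (hasSum_matrixTerm b z m (k - 1)).mul_left ((Real.sqrt k : ℝ) : ℂ)
  -- This is the series of `⟨m| a D(z) - D(z) a |k⟩`; its terms are commutators of `a` with powers
  -- of the generator.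
  have h3 := h1.sub h2
  rw [← sub_eq_iff_eq_add']
  refine h3.unique (hasSum_shifted_matrixTerm (hasSum_matrixTerm b z m k) ?_ fun j => ?_)
  · have := lowering_apply (Finsupp.single k 1) m
    rw [lowering_single, single_eq_smul, Finsupp.smul_apply, smul_eq_mul] at this
    simp [matrixTerm, this]
  · have := congr($(mul_pow_succ_of_mul_eq (lowering_mul_shiftGen z) j) (Finsupp.single k 1) m)
    simp only [Module.End.mul_apply, LinearMap.add_apply, Finsupp.add_apply, lowering_apply,
      lowering_single, LinearMap.smul_apply, Finsupp.smul_apply, smul_eq_mul] at this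
    rw [single_eq_smul (k - 1), map_smul, Finsupp.smul_apply, smul_eq_mul] at this
    simp only [matrixTerm]
    linear_combination ((j + 1).factorial : ℂ)⁻¹ * this

/-- Comes from `a* D(z) = D(z) (a* + conj z)` and `⟨0| a* = 0`. It supplies the row `m = 0`, from
which the lowering recursion starts. -/
lemma matrixElement_zero_succ (b : HilbertBasis ℕ ℂ H) (z : ℂ) (k : ℕ) :
    ((Real.sqrt (k + 1) : ℝ) : ℂ) * inner ℂ (b 0) (shift b z (b (k + 1)))
      = -conj z * inner ℂ (b 0) (shift b z (b k)) := by
  have h1 := (hasSum_matrixTerm b z 0 (k + 1)).mul_left (-((Real.sqrt (k + 1) : ℝ) : ℂ))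
  suffices h : -((Real.sqrt (k + 1) : ℝ) : ℂ) * inner ℂ (b 0) (shift b z (b (k + 1)))
      = conj z * inner ℂ (b 0) (shift b z (b k)) by linear_combination -h
  refine h1.unique (hasSum_shifted_matrixTerm (hasSum_matrixTerm b z 0 k) ?_ fun j => ?_)
  · simp [matrixTerm]
  · have := congr($(mul_pow_succ_of_mul_eq (raising_mul_shiftGen z) j) (Finsupp.single k 1) 0)
    simp only [Module.End.mul_apply, LinearMap.add_apply, Finsupp.add_apply, raising_apply_zero,
      raising_single, LinearMap.smul_apply, Finsupp.smul_apply, smul_eq_mul] at this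
    rw [single_eq_smul (k + 1), map_smul, Finsupp.smul_apply, smul_eq_mul] at this
    simp only [matrixTerm]
    linear_combination ((j + 1).factorial : ℂ)⁻¹ * this

/-- At the vacuum coordinate only the `-conj z • a` part of the leftmost generator survives. Moving
this `a` to the right until it kills `|0⟩` leaves the commutator term alone. -/
lemma vacuum_moment_succ_succ (z : ℂ) (j : ℕ) :
    (shiftGen z ^ (j + 2)) (Finsupp.single 0 1) 0
      = -(conj z * z) * (j + 1) * (shiftGen z ^ j) (Finsupp.single 0 1) 0 := by
  have h := congr($(mul_pow_succ_of_mul_eq (lowering_mul_shiftGen z) j) (Finsupp.single 0 1) 0)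
  simp only [Module.End.mul_apply, LinearMap.add_apply, Finsupp.add_apply,
      lowering_single, LinearMap.smul_apply, Finsupp.smul_apply, smul_eq_mul] at h
  simp only [Nat.cast_zero, Real.sqrt_zero, Complex.ofReal_zero, Finsupp.single_zero, map_zero,
    Finsupp.coe_zero, Pi.zero_apply, zero_add] at h
  have hs f : shiftGen z f 0 = -conj z * lowering f 0 := by
    simp [shiftGen, raising_apply_zero]
  rw [pow_succ', Module.End.mul_apply, hs, h]
  ring

lemma matrixTerm_zero_even (z : ℂ) (i : ℕ) :
    matrixTerm z 0 0 (2 * i) = (-(conj z * z) / 2) ^ i / i.factorial := by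
  induction i with
  | zero => simp [matrixTerm]
  | succ i ih =>
    have h1 : (i.factorial : ℂ) ≠ 0 := by exact_mod_cast i.factorial_ne_zero
    have h2 : ((2 * i).factorial : ℂ) ≠ 0 := by exact_mod_cast (2 * i).factorial_ne_zero
    have h3 : (i + 1 : ℂ) ≠ 0 := by exact_mod_cast i.succ_ne_zero
    have h4 : (2 * i + 1 : ℂ) ≠ 0 := by exact_mod_cast (2 * i).succ_ne_zero
    rw [matrixTerm] at ih ⊢
    rw [show 2 * (i + 1) = 2 * i + 2 by ring, vacuum_moment_succ_succ, Nat.factorial_succ,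
      Nat.factorial_succ, Nat.factorial_succ i, pow_succ]
    have ih' := congr(-(conj z * z) / 2 / (i + 1) * $ih)
    push_cast
    calc _ = -(conj z * z) / 2 / (i + 1) *
        (((2 * i).factorial : ℂ)⁻¹ * (shiftGen z ^ (2 * i)) (Finsupp.single 0 1) 0) := by
          have h5 : (2 * i + 1 + 1 : ℂ) = 2 * (i + 1) := by ring
          rw [h5]
          field_simp
      _ = _ := by rw [ih']; field_simp

lemma matrixTerm_zero_odd (z : ℂ) (i : ℕ) : matrixTerm z 0 0 (2 * i + 1) = 0 := by
  have : (shiftGen z ^ (2 * i + 1)) (Finsupp.single 0 1) 0 = 0 := by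
    induction i with
    | zero => simp [shiftGen_single]
    | succ i ih =>
      rw [show 2 * (i + 1) + 1 = 2 * i + 1 + 2 by ring, vacuum_moment_succ_succ, ih, mul_zero]
  rw [matrixTerm, this, mul_zero]

lemma matrixElement_zero_zero (b : HilbertBasis ℕ ℂ H) (z : ℂ) :
    inner ℂ (b 0) (shift b z (b 0)) = Complex.exp (-(conj z * z) / 2) := by
  refine (hasSum_matrixTerm b z 0 0).unique ?_
  have he : HasSum (fun i => matrixTerm z 0 0 (2 * i)) (Complex.exp (-(conj z * z) / 2)) := by
    simp only [matrixTerm_zero_even]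
    rw [Complex.exp_eq_exp_ℂ]
    exact NormedSpace.expSeries_div_hasSum_exp _
  have ho : HasSum (fun i => matrixTerm z 0 0 (2 * i + 1)) 0 := by
    simp only [matrixTerm_zero_odd]
    exact hasSum_zero
  simpa using he.even_add_odd ho

/-- The coefficient of `x^k` in `(z + x)^m exp(w x)`. -/
def displacementPoly (z w : ℂ) (m k : ℕ) : ℂ :=
  ∑ p ∈ Finset.HasAntidiagonal.antidiagonal k, (m.choose p.1 : ℂ) * z ^ (m - p.1) * (w ^ p.2 / p.2.factorial)

/-- With a generating function in `k`, raising `m` by one is multiplication by `X + z`, which is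
exactly the recursion of the matrix elements. -/
lemma displacementPoly_eq_coeff (z w : ℂ) (m k : ℕ) : displacementPoly z w m k =
    PowerSeries.coeff k ((PowerSeries.X + PowerSeries.C z) ^ m
      * PowerSeries.mk fun l => w ^ l / l.factorial) := by
  rw [PowerSeries.coeff_mul]
  refine Finset.sum_congr rfl fun p _ => ?_
  have h := Polynomial.coeff_X_add_C_pow z m p.1
  rw [← Polynomial.coeff_coe] at h
  push_cast at h
  rw [h, PowerSeries.coeff_mk]
  ring

lemma displacementPoly_succ_succ (z w : ℂ) (m k : ℕ) : displacementPoly z w (m + 1) (k + 1) =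
    displacementPoly z w m k + z * displacementPoly z w m (k + 1) := by
  simp only [displacementPoly_eq_coeff]
  rw [pow_succ', mul_assoc, add_mul, map_add, PowerSeries.coeff_succ_X_mul,
    PowerSeries.coeff_C_mul]

lemma displacementPoly_succ_zero (z w : ℂ) (m : ℕ) : displacementPoly z w (m + 1) 0 =
    z * displacementPoly z w m 0 := by
  simp [displacementPoly, pow_succ']

lemma sqrt_factorial_succ (n : ℕ) : ((Real.sqrt (n + 1).factorial : ℝ) : ℂ)
    = (Real.sqrt (n + 1) : ℝ) * (Real.sqrt n.factorial : ℝ) := by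
  rw [Nat.factorial_succ, Nat.cast_mul, Real.sqrt_mul (by positivity)]
  push_cast
  rfl

lemma ofReal_sqrt_ne_zero {x : ℝ} (hx : 0 < x) : ((Real.sqrt x : ℝ) : ℂ) ≠ 0 := by
  exact_mod_cast (Real.sqrt_pos.2 hx).ne'

/-- The matrix elements of the shift operator in the number basis. -/
lemma matrixElement_eq (b : HilbertBasis ℕ ℂ H) (z : ℂ) (m k : ℕ) :
    inner ℂ (b m) (shift b z (b k)) =
      (Real.sqrt k.factorial : ℝ) / (Real.sqrt m.factorial : ℝ) * Complex.exp (-(conj z * z) / 2)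
        * displacementPoly z (-conj z) m k := by
  induction m generalizing k with
  | zero =>
    induction k with
    | zero => simp [displacementPoly, matrixElement_zero_zero]
    | succ k ih =>
      have hd : ∀ k, displacementPoly z (-conj z) 0 k = (-conj z) ^ k / k.factorial := by
        intro k
        simp only [displacementPoly_eq_coeff, pow_zero, one_mul, PowerSeries.coeff_mk]
      have h := matrixElement_zero_succ b z k
      have h1 := ofReal_sqrt_ne_zero (x := k + 1) (by positivity)
      have h4 := sqrt_mul_sqrt_natCast (k + 1)
      push_cast at h4
      have h2 : (k.factorial : ℂ) ≠ 0 := by exact_mod_cast k.factorial_ne_zero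
      have h3 : (k + 1 : ℂ) ≠ 0 := by exact_mod_cast k.succ_ne_zero
      rw [ih, hd] at h
      apply mul_left_cancel₀ h1
      rw [h, hd, sqrt_factorial_succ, Nat.factorial_succ]
      push_cast
      simp only [Nat.factorial_zero, Nat.cast_one, Real.sqrt_one, Complex.ofReal_one, div_one]
      field_simp
      rw [pow_two, h4]
      ring
  | succ m ih =>
    have h := matrixElement_succ b z m k
    have h1 := ofReal_sqrt_ne_zero (x := m + 1) (by positivity)
    have h2 := ofReal_sqrt_ne_zero (x := m.factorial) (by positivity)
    apply mul_left_cancel₀ h1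
    rw [h, ih, ih, sqrt_factorial_succ]
    rcases k with _ | k
    · rw [displacementPoly_succ_zero]
      simp
      field_simp
    · have h3 := sqrt_factorial_succ k
      rw [displacementPoly_succ_succ, Nat.add_sub_cancel, h3]
      push_cast
      field_simp

/-! ### Polar form and Gaussian moments -/

/-- The polynomial part of the radial matrix elements of the shift operator. -/
def radialPoly (m k : ℕ) : Polynomial ℝ :=
  ∑ p ∈ Finset.HasAntidiagonal.antidiagonal k,
    Polynomial.C ((m.choose p.1 : ℝ) * (-1) ^ p.2 / p.2.factorial)
      * Polynomial.X ^ (m - p.1 + p.2)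

/-- All terms share one phase: the pair `(i, l)` contributes `m - i` factors `e^{iθ}` and `l`
factors `e^{-iθ}`, and `i + l = k`. Where `m - i` truncates, the binomial coefficient is zero. -/
lemma displacementPoly_polar (m k : ℕ) (r θ : ℝ) :
    displacementPoly (r * Complex.exp (θ * Complex.I)) (-conj (r * Complex.exp (θ * Complex.I))) m k
      = Complex.exp (((m : ℂ) - k) * θ * Complex.I) * ((radialPoly m k).eval r : ℝ) := by
  have hconj : conj (r * Complex.exp (θ * Complex.I)) = r * Complex.exp (-(θ * Complex.I)) := by
    rw [map_mul, ← Complex.exp_conj, map_mul, Complex.conj_ofReal, Complex.conj_ofReal,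
      Complex.conj_I, mul_neg]
  rw [displacementPoly, radialPoly, Polynomial.eval_finsetSum, Complex.ofReal_sum, Finset.mul_sum]
  refine Finset.sum_congr rfl fun p hp => ?_
  rw [Finset.HasAntidiagonal.mem_antidiagonal] at hp
  by_cases hm : p.1 ≤ m
  · have he : Complex.exp (((m : ℂ) - k) * θ * Complex.I)
        = Complex.exp (θ * Complex.I) ^ (m - p.1) * Complex.exp (-(θ * Complex.I)) ^ p.2 := by
      rw [← Complex.exp_nat_mul, ← Complex.exp_nat_mul, ← Complex.exp_add, ← hp]
      congr 1
      push_cast [hm]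
      ring
    rw [hconj, he]
    simp only [Polynomial.eval_mul, Polynomial.eval_C, Polynomial.eval_pow, Polynomial.eval_X]
    push_cast
    rw [neg_eq_neg_one_mul, mul_pow, mul_pow, mul_pow, pow_add]
    ring
  · rw [Nat.choose_eq_zero_of_lt (not_le.1 hm)]
    simp

lemma gaussian_moment (s : ℕ) :
    ∫ r in Set.Ioi (0 : ℝ), r ^ (2 * s + 1) * Real.exp (-r ^ 2) = s.factorial / 2 := by
  have h := integral_rpow_mul_exp_neg_rpow (p := 2) (q := (2 * s + 1 : ℕ)) (by norm_num)
    (by have : (0 : ℝ) ≤ (2 * s + 1 : ℕ) := by positivity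
        linarith)
  have e : (((2 * s + 1 : ℕ) : ℝ) + 1) / 2 = s + 1 := by push_cast; ring
  rw [e, Real.Gamma_nat_eq_factorial] at h
  simp only [Real.rpow_natCast, Real.rpow_two] at h
  rw [h]
  ring

lemma integrableOn_pow_mul_gaussian (n : ℕ) :
    IntegrableOn (fun r : ℝ => r ^ n * Real.exp (-r ^ 2)) (Set.Ioi 0) := by
  have h := integrableOn_rpow_mul_exp_neg_rpow (p := 2) (s := n)
    (by have : (0 : ℝ) ≤ n := by positivity
        linarith) (by norm_num)
  simpa only [Real.rpow_natCast, Real.rpow_two] using h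

lemma integrableOn_poly_mul_gaussian (P : Polynomial ℝ) :
    IntegrableOn (fun r : ℝ => P.eval r * Real.exp (-r ^ 2)) (Set.Ioi 0) := by
  induction P using Polynomial.induction_on' with
  | add p q hp hq =>
    simp only [Polynomial.eval_add, add_mul]
    exact hp.add hq
  | monomial n c =>
    simp only [Polynomial.eval_monomial, mul_assoc]
    exact (integrableOn_pow_mul_gaussian n).const_mul c

/-! ### Alternating binomial sums by power series -/

/-- The alternating sum `∑ (-1)^j C(m,j) C(a+l,a)` over `j + l = k`. -/
def binomialSum (m a k : ℕ) : ℝ :=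
  ∑ p ∈ Finset.HasAntidiagonal.antidiagonal k,
    (-1 : ℝ) ^ p.1 * (m.choose p.1 : ℝ) * ((a + p.2).choose a : ℝ)

lemma coeff_one_sub_X_pow (m k : ℕ) :
    PowerSeries.coeff k ((1 - PowerSeries.X : PowerSeries ℝ) ^ m)
      = (-1) ^ k * (m.choose k : ℝ) := by
  have h := Polynomial.coeff_one_add_X_pow ℝ m k
  have e : ((1 - PowerSeries.X : PowerSeries ℝ) ^ m)
      = PowerSeries.evalNegHom (((1 + Polynomial.X : Polynomial ℝ) ^ m : Polynomial ℝ) :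
          PowerSeries ℝ) := by
    push_cast
    rw [map_pow, map_add, map_one, PowerSeries.evalNegHom_X, sub_eq_add_neg]
  rw [e, PowerSeries.evalNegHom, PowerSeries.coeff_rescale, Polynomial.coeff_coe, h]

lemma binomialSum_eq_coeff (m a k : ℕ) : binomialSum m a k =
    PowerSeries.coeff k ((1 - PowerSeries.X : PowerSeries ℝ) ^ m
      * (PowerSeries.invOneSubPow ℝ (a + 1)).val) := by
  rw [PowerSeries.coeff_mul, PowerSeries.invOneSubPow_val_succ_eq_mk_add_choose]
  refine Finset.sum_congr rfl fun p _ => ?_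
  rw [coeff_one_sub_X_pow, PowerSeries.coeff_mk]

lemma one_sub_X_pow_mul_inv (a : ℕ) : (1 - PowerSeries.X : PowerSeries ℝ) ^ a
      * (PowerSeries.invOneSubPow ℝ a).val = 1 := by
  rw [← PowerSeries.invOneSubPow_inv_eq_one_sub_pow]
  exact (PowerSeries.invOneSubPow ℝ a).inv_val

/-- The generating function `(1-X)^m (1-X)^{-(a+1)}` collapses to the polynomial `(1-X)^d`. -/
lemma binomialSum_of_lt (a d k : ℕ) :
    binomialSum (a + 1 + d) a k = (-1) ^ k * (d.choose k : ℝ) := by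
  rw [binomialSum_eq_coeff, pow_add, mul_right_comm, one_sub_X_pow_mul_inv, one_mul,
    coeff_one_sub_X_pow]

/-- Here the generating function is the geometric series `1/(1-X)`. -/
lemma binomialSum_self (m k : ℕ) : binomialSum m m k = 1 := by
  have h : (1 - PowerSeries.X : PowerSeries ℝ) ^ m * (PowerSeries.invOneSubPow ℝ (m + 1)).val
      = (PowerSeries.invOneSubPow ℝ 1).val := by
    rw [PowerSeries.invOneSubPow_add, Units.val_mul, ← mul_assoc, one_sub_X_pow_mul_inv, one_mul]
  rw [binomialSum_eq_coeff, h, PowerSeries.invOneSubPow_val_succ_eq_mk_add_choose]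
  simp

/-- The parity condition `h` makes every exponent odd, equal to `2(a+l) + 1`, so each moment is
`(a+l)!/2`; with the `1/l!` of the polynomial this gives `a! C(a+l,a)/2`. -/
lemma integral_radialPoly_mul_pow {m k e a : ℕ} (h : m + e = 2 * a + k) :
    ∫ r in Set.Ioi (0 : ℝ), ((radialPoly m k).eval r * r ^ (e + 1)) * Real.exp (-r ^ 2)
      = (-1) ^ k * a.factorial / 2 * binomialSum m a k := by
  have h1 : ∀ r : ℝ, ((radialPoly m k).eval r * r ^ (e + 1)) * Real.exp (-r ^ 2)
      = ∑ p ∈ Finset.HasAntidiagonal.antidiagonal k,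
        ((m.choose p.1 : ℝ) * (-1) ^ p.2 / p.2.factorial)
          * (r ^ (2 * (a + p.2) + 1) * Real.exp (-r ^ 2)) := by
    intro r
    rw [radialPoly, Polynomial.eval_finsetSum, Finset.sum_mul, Finset.sum_mul]
    refine Finset.sum_congr rfl fun p hp => ?_
    rw [Finset.HasAntidiagonal.mem_antidiagonal] at hp
    by_cases hm : p.1 ≤ m
    · rw [show 2 * (a + p.2) + 1 = (m - p.1 + p.2) + (e + 1) by omega, pow_add r (m - p.1 + p.2)]
      simp only [Polynomial.eval_mul, Polynomial.eval_C, Polynomial.eval_pow, Polynomial.eval_X]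
      ring
    · rw [Nat.choose_eq_zero_of_lt (not_le.1 hm)]
      simp
  simp only [h1]
  rw [integral_finsetSum _ fun p _ => (integrableOn_pow_mul_gaussian _).const_mul _, binomialSum,
    Finset.mul_sum]
  refine Finset.sum_congr rfl fun p hp => ?_
  rw [Finset.HasAntidiagonal.mem_antidiagonal] at hp
  rw [integral_const_mul, gaussian_moment]
  have hc : (((a + p.2).choose a : ℕ) : ℝ) * a.factorial * p.2.factorial
      = (a + p.2).factorial := by
    have := Nat.choose_mul_factorial_mul_factorial (Nat.le_add_right a p.2)
    rw [Nat.add_sub_cancel_left] at this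
    exact_mod_cast this
  have hf : (p.2.factorial : ℝ) ≠ 0 := by positivity
  have hs : (-1 : ℝ) ^ k * (-1) ^ p.1 = (-1) ^ p.2 := by
    rw [← hp, pow_add, mul_right_comm, ← pow_add, ← two_mul, pow_mul]
    simp
  rw [← hc, ← hs]
  field_simp

/-! ### Radial integrals -/

/-- The radial part of the matrix element `⟨m| D(r e^{iθ}) |k⟩`. -/
def radial (m k : ℕ) (r : ℝ) : ℝ :=
  Real.sqrt k.factorial / Real.sqrt m.factorial * Real.exp (-r ^ 2 / 2) * (radialPoly m k).eval r

lemma radial_mul_radial (m n k : ℕ) (r : ℝ) : radial m k r * radial n k r * r =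
    k.factorial / (Real.sqrt m.factorial * Real.sqrt n.factorial) *
      ((radialPoly n k).eval r * (radialPoly m k).eval r * r * Real.exp (-r ^ 2)) := by
  have h1 : Real.exp (-r ^ 2) = Real.exp (-r ^ 2 / 2) * Real.exp (-r ^ 2 / 2) := by
    rw [← Real.exp_add]; ring_nf
  have h2 : Real.sqrt k.factorial ^ 2 = k.factorial := Real.sq_sqrt (by positivity)
  rw [radial, radial, h1]
  field_simp
  rw [h2]
  ring

lemma integrableOn_radial_mul_radial (m n k : ℕ) :
    IntegrableOn (fun r => radial m k r * radial n k r * r) (Set.Ioi 0) := by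
  simp only [radial_mul_radial]
  have := integrableOn_poly_mul_gaussian (radialPoly n k * radialPoly m k * Polynomial.X)
  simp only [Polynomial.eval_mul, Polynomial.eval_X] at this
  exact this.const_mul _

/-- Expand one of the two polynomials. Its term `(i, l)` leads to a binomial sum with `a = m - i`;
for `i > 0` this is `± C(i-1, k) = 0` because `k ≥ i`, so only `i = 0` remains. -/
lemma integral_radial_sq (m k : ℕ) :
    ∫ r in Set.Ioi (0 : ℝ), radial m k r * radial m k r * r = 1 / 2 := by
  have h1 : ∀ r : ℝ, (radialPoly m k).eval r * (radialPoly m k).eval r * r * Real.exp (-r ^ 2)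
      = ∑ p ∈ Finset.HasAntidiagonal.antidiagonal k,
        ((m.choose p.1 : ℝ) * (-1) ^ p.2 / p.2.factorial)
          * ((radialPoly m k).eval r * r ^ (m - p.1 + p.2 + 1) * Real.exp (-r ^ 2)) := by
    intro r
    conv_lhs => enter [1, 1, 2]; rw [radialPoly, Polynomial.eval_finsetSum]
    rw [Finset.mul_sum, Finset.sum_mul, Finset.sum_mul]
    refine Finset.sum_congr rfl fun p hp => ?_
    simp only [Polynomial.eval_mul, Polynomial.eval_C, Polynomial.eval_pow, Polynomial.eval_X]
    ring
  have hint : ∀ e : ℕ, IntegrableOn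
      (fun r => (radialPoly m k).eval r * r ^ e * Real.exp (-r ^ 2)) (Set.Ioi 0) := by
    intro e
    have := integrableOn_poly_mul_gaussian (radialPoly m k * Polynomial.X ^ e)
    simpa only [Polynomial.eval_mul, Polynomial.eval_X, Polynomial.eval_pow] using this
  simp only [radial_mul_radial]
  rw [integral_const_mul]
  simp only [h1]
  rw [integral_finsetSum _ fun p _ => (hint _).const_mul _]
  have h2 : ∀ p ∈ Finset.HasAntidiagonal.antidiagonal k,
      ∫ r in Set.Ioi (0 : ℝ), ((m.choose p.1 : ℝ) * (-1) ^ p.2 / p.2.factorial)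
          * ((radialPoly m k).eval r * r ^ (m - p.1 + p.2 + 1) * Real.exp (-r ^ 2))
      = if p = (0, k) then (m.factorial / k.factorial / 2 : ℝ) else 0 := by
    rintro ⟨i, l⟩ hp
    rw [Finset.HasAntidiagonal.mem_antidiagonal] at hp
    simp only at hp ⊢
    rw [integral_const_mul]
    by_cases hi : i ≤ m
    · rw [integral_radialPoly_mul_pow (a := m - i) (by omega)]
      rcases i with _ | i
      · have hl : l = k := by omega
        subst hl
        simp only [Nat.sub_zero, binomialSum_self, if_true, Nat.choose_zero_right]
        have : (-1 : ℝ) ^ l * (-1) ^ l = 1 := by rw [← pow_add, ← two_mul, pow_mul]; simp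
        push_cast
        linear_combination (m.factorial / l.factorial / 2 : ℝ) * this
      · have hb := binomialSum_of_lt (m - (i + 1)) i k
        rw [show m - (i + 1) + 1 + i = m by omega, Nat.choose_eq_zero_of_lt (by omega)] at hb
        rw [hb]
        simp
    · rw [Nat.choose_eq_zero_of_lt (not_le.1 hi), if_neg (by simp; omega)]
      simp
  rw [Finset.sum_congr rfl h2, Finset.sum_ite_eq', if_pos (by simp),
    Real.mul_self_sqrt (by positivity)]
  have : (m.factorial : ℝ) ≠ 0 := by positivity
  have : (k.factorial : ℝ) ≠ 0 := by positivity
  field_simp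

lemma radialPoly_zero (k : ℕ) :
    radialPoly 0 k = Polynomial.C ((-1) ^ k / k.factorial : ℝ) * Polynomial.X ^ k := by
  rw [radialPoly, Finset.sum_eq_single (0, k)]
  · simp
  · rintro ⟨i, l⟩ hp hne
    rw [Finset.HasAntidiagonal.mem_antidiagonal] at hp
    have : 0 < i := by
      rcases i with _ | i
      · simp_all
      · omega
    simp [Nat.choose_eq_zero_of_lt this]
  · simp

/-- The row `m = 0` is a monomial `r^k`, so the moment formula applies with `e = k`, `a = d + 1`.
The even index `2(d+1)` is what leaves `(1-X)^d`, hence a value that vanishes for `k > d`. -/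
lemma integral_radial_zero_mul_radial (d k : ℕ) :
    ∫ r in Set.Ioi (0 : ℝ), radial 0 k r * radial (2 * (d + 1)) k r * r
      = (d + 1).factorial / (2 * Real.sqrt (2 * (d + 1)).factorial)
        * ((-1) ^ k * (d.choose k : ℝ)) := by
  have h1 : ∀ r : ℝ, (radialPoly (2 * (d + 1)) k).eval r * (radialPoly 0 k).eval r * r
      * Real.exp (-r ^ 2) = ((-1) ^ k / k.factorial : ℝ) *
        ((radialPoly (2 * (d + 1)) k).eval r * r ^ (k + 1) * Real.exp (-r ^ 2)) := by
    intro r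
    rw [radialPoly_zero]
    simp only [Polynomial.eval_mul, Polynomial.eval_C, Polynomial.eval_pow, Polynomial.eval_X]
    ring
  simp only [radial_mul_radial, h1]
  have hb := binomialSum_of_lt (d + 1) d k
  rw [show d + 1 + 1 + d = 2 * (d + 1) by omega] at hb
  rw [integral_const_mul, integral_const_mul, integral_radialPoly_mul_pow (a := d + 1) rfl, hb]
  have hk : (k.factorial : ℝ) ≠ 0 := by positivity
  have hs : (-1 : ℝ) ^ k * (-1) ^ k = 1 := by rw [← pow_add, ← two_mul, pow_mul]; simp
  have h2 : Real.sqrt (2 * (d + 1)).factorial ≠ 0 := (Real.sqrt_pos.2 (by positivity)).ne'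
  simp only [Nat.factorial_zero, Nat.cast_one, Real.sqrt_one, one_mul]
  field_simp
  rw [pow_two, hs, one_mul]

lemma matrixElement_polar (b : HilbertBasis ℕ ℂ H) (m k : ℕ) (r θ : ℝ) :
    inner ℂ (b m) (shift b (r * Complex.exp (θ * Complex.I)) (b k)) =
      Complex.exp (((m : ℂ) - k) * θ * Complex.I) * (radial m k r : ℝ) := by
  have h : conj (r * Complex.exp (θ * Complex.I)) * (r * Complex.exp (θ * Complex.I))
      = ((r ^ 2 : ℝ) : ℂ) := by
    rw [← Complex.normSq_eq_conj_mul_self, Complex.normSq_eq_norm_sq, norm_mul,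
      Complex.norm_exp_ofReal_mul_I, Complex.norm_real, mul_one, Real.norm_eq_abs, sq_abs]
  rw [matrixElement_eq, displacementPoly_polar, h, radial]
  push_cast
  ring

/-! ### Orthogonality relations and square integrable amplitudes -/

/-- The matrix element `⟨m| D(r e^{iθ}) |k⟩` as a function of the polar coordinates `p = (θ, r)`. -/
def polarElement (m k : ℕ) (p : ℝ × ℝ) : ℂ :=
  Complex.exp (((m : ℂ) - k) * p.1 * Complex.I) * (radial m k p.2 : ℝ)

lemma continuous_radial (m k : ℕ) : Continuous (radial m k) := by
  unfold radial
  fun_prop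

lemma continuous_polarElement (m k : ℕ) : Continuous (polarElement m k) := by
  have := continuous_radial m k
  unfold polarElement
  fun_prop

lemma integral_exp_int_angle (m n : ℕ) :
    ∫ θ in Set.Ico 0 (2 * Real.pi), Complex.exp (((m : ℂ) - n) * θ * Complex.I)
      = if m = n then 2 * (Real.pi : ℂ) else 0 := by
  rw [integral_Ico_eq_integral_Ioc, ← intervalIntegral.integral_of_le (by positivity)]
  split_ifs with h
  · simp [h]
  · have hc : ((m : ℂ) - n) * Complex.I ≠ 0 := by
      refine mul_ne_zero (sub_ne_zero.2 ?_) Complex.I_ne_zero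
      exact_mod_cast h
    have h2 := integral_exp_mul_complex (a := 0) (b := 2 * Real.pi) hc
    simp only [mul_right_comm _ Complex.I] at h2
    rw [h2]
    have h3 : Complex.exp (((m : ℂ) - n) * ((2 * Real.pi : ℝ) : ℂ) * Complex.I) = 1 := by
      rw [Complex.exp_eq_one_iff]
      refine ⟨(m : ℤ) - n, ?_⟩
      push_cast
      ring
    rw [h3]
    simp

/-- The half strip of polar coordinates `(θ, r)`. -/
def polarStrip : Set (ℝ × ℝ) := Set.Ico 0 (2 * Real.pi) ×ˢ Set.Ioi 0

lemma measurableSet_polarStrip : MeasurableSet polarStrip :=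
  measurableSet_Ico.prod measurableSet_Ioi

lemma volume_restrict_prod (A B : Set ℝ) : (volume : Measure (ℝ × ℝ)).restrict (A ×ˢ B)
    = (volume.restrict A).prod (volume.restrict B) := by
  rw [Measure.prod_restrict, Measure.volume_eq_prod]

lemma polarElement_mul_conj (m n k : ℕ) (p : ℝ × ℝ) :
    polarElement m k p * conj (polarElement n k p) * p.2
      = Complex.exp (((m : ℂ) - n) * p.1 * Complex.I)
        * ((radial m k p.2 * radial n k p.2 * p.2 : ℝ) : ℂ) := by
  have h : Complex.exp (((m : ℂ) - n) * p.1 * Complex.I)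
      = Complex.exp (((m : ℂ) - k) * p.1 * Complex.I)
        * conj (Complex.exp (((n : ℂ) - k) * p.1 * Complex.I)) := by
    rw [← Complex.exp_conj, ← Complex.exp_add]
    simp only [map_mul, map_sub, map_natCast, Complex.conj_ofReal, Complex.conj_I]
    ring_nf
  rw [polarElement, polarElement, h, map_mul, Complex.conj_ofReal]
  push_cast
  ring

lemma integrableOn_exp_angle (c : ℂ) (A : Set ℝ) (hA : A ⊆ Set.Ico 0 (2 * Real.pi)) :
    IntegrableOn (fun θ : ℝ => Complex.exp (c * θ * Complex.I)) A := by
  refine IntegrableOn.mono_set (t := Set.Icc 0 (2 * Real.pi)) ?_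
    (hA.trans Set.Ico_subset_Icc_self)
  exact Continuous.integrableOn_Icc (by fun_prop)

lemma integrableOn_polarElement (m n k : ℕ) :
    IntegrableOn (fun p => polarElement m k p * conj (polarElement n k p) * p.2) polarStrip := by
  rw [IntegrableOn, polarStrip, volume_restrict_prod]
  simp only [polarElement_mul_conj]
  exact (integrableOn_exp_angle _ _ subset_rfl).mul_prod
    (Integrable.ofReal (integrableOn_radial_mul_radial m n k))

lemma integral_polarElement (m n k : ℕ) :
    ∫ p in polarStrip, polarElement m k p * conj (polarElement n k p) * p.2
      = if m = n then (Real.pi : ℂ) else 0 := by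
  rw [polarStrip, volume_restrict_prod]
  simp only [polarElement_mul_conj]
  rw [integral_prod_mul (μ := volume.restrict (Set.Ico 0 (2 * Real.pi)))
    (ν := volume.restrict (Set.Ioi 0))
    (fun θ : ℝ => Complex.exp (((m : ℂ) - n) * θ * Complex.I))
    (fun r : ℝ => ((radial m k r * radial n k r * r : ℝ) : ℂ)), integral_exp_int_angle]
  split_ifs with h
  · subst h
    rw [integral_complex_ofReal, integral_radial_sq]
    push_cast
    ring
  · simp

/-- Pythagoras for the orthogonality relations, put as a lower integral so that Fatou's lemma can
follow. -/
lemma lintegral_sum_polarElement (s : Finset ℕ) (c : ℕ → ℂ) (k : ℕ) :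
    ∫⁻ p in polarStrip, ENNReal.ofReal (‖∑ m ∈ s, c m * polarElement m k p‖ ^ 2 * p.2)
      = ENNReal.ofReal (Real.pi * ∑ m ∈ s, ‖c m‖ ^ 2) := by
  have h1 : ∀ p : ℝ × ℝ, ((‖∑ m ∈ s, c m * polarElement m k p‖ ^ 2 * p.2 : ℝ) : ℂ)
      = ∑ m ∈ s, ∑ n ∈ s, c m * conj (c n)
        * (polarElement m k p * conj (polarElement n k p) * p.2) := by
    intro p
    push_cast
    rw [← Complex.mul_conj', map_sum, Finset.sum_mul_sum, Finset.sum_mul]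
    refine Finset.sum_congr rfl fun m _ => ?_
    rw [Finset.sum_mul]
    refine Finset.sum_congr rfl fun n _ => ?_
    rw [map_mul]
    ring
  have hi : ∀ m ∈ s, ∀ n ∈ s, IntegrableOn (fun p => c m * conj (c n)
        * (polarElement m k p * conj (polarElement n k p) * p.2)) polarStrip :=
    fun m _ n _ => (integrableOn_polarElement m n k).const_mul _
  have hint : IntegrableOn (fun p : ℝ × ℝ =>
      ((‖∑ m ∈ s, c m * polarElement m k p‖ ^ 2 * p.2 : ℝ) : ℂ)) polarStrip := by
    simp only [h1]
    exact integrable_finsetSum _ fun m hm => integrable_finsetSum _ fun n hn => hi m hm n hn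
  have hval : ∫ p in polarStrip, ((‖∑ m ∈ s, c m * polarElement m k p‖ ^ 2 * p.2 : ℝ) : ℂ)
      = ((Real.pi * ∑ m ∈ s, ‖c m‖ ^ 2 : ℝ) : ℂ) := by
    simp only [h1]
    rw [integral_finsetSum _ fun m hm => integrable_finsetSum _ fun n hn => hi m hm n hn]
    push_cast
    rw [Finset.mul_sum]
    refine Finset.sum_congr rfl fun m hm => ?_
    rw [integral_finsetSum _ fun n hn => hi m hm n hn]
    simp only [integral_const_mul, integral_polarElement]
    simp only [mul_ite, mul_zero, Finset.sum_ite_eq, hm, if_true]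
    rw [Complex.mul_conj']
    ring
  rw [integral_complex_ofReal] at hval
  rw [← Complex.ofReal_injective hval, ofReal_integral_eq_lintegral_ofReal]
  · have := hint.re
    simp only [RCLike.re_to_complex, Complex.ofReal_re] at this
    exact this
  · filter_upwards [ae_restrict_mem measurableSet_polarStrip] with p hp
    have : 0 < p.2 := hp.2
    positivity

/-- The amplitude `⟨φ, D(r e^{iθ}) |k⟩⟩` as a function of the polar coordinates `(θ, r)`. -/
def amplitude (b : HilbertBasis ℕ ℂ H) (φ : H) (k : ℕ) (p : ℝ × ℝ) : ℂ :=
  inner ℂ φ (shift b (p.2 * Complex.exp (p.1 * Complex.I)) (b k))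

lemma amplitude_basis (b : HilbertBasis ℕ ℂ H) (m k : ℕ) (p : ℝ × ℝ) :
    amplitude b (b m) k p = polarElement m k p :=
  matrixElement_polar b m k p.2 p.1

lemma hasSum_amplitude (b : HilbertBasis ℕ ℂ H) (φ : H) (k : ℕ) (p : ℝ × ℝ) :
    HasSum (fun m => inner ℂ φ (b m) * polarElement m k p) (amplitude b φ k p) := by
  simp only [← amplitude_basis b]
  exact b.hasSum_inner_mul_inner φ _

lemma measurable_amplitude (b : HilbertBasis ℕ ℂ H) (φ : H) (k : ℕ) :
    Measurable (amplitude b φ k) := by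
  refine measurable_of_tendsto_metrizable
    (f := fun N p => ∑ m ∈ Finset.range N, inner ℂ φ (b m) * polarElement m k p) (fun N => ?_) ?_
  · exact Finset.measurable_fun_sum _ fun m _ =>
      ((continuous_polarElement m k).measurable.const_mul _)
  · exact tendsto_pi_nhds.2 fun p => (hasSum_amplitude b φ k p).tendsto_sum_nat

/-- The amplitudes of a vector are square integrable over the phase space. -/
lemma lintegral_amplitude_sq_le (b : HilbertBasis ℕ ℂ H) (φ : H) (k : ℕ) :
    ∫⁻ p in polarStrip, ENNReal.ofReal (‖amplitude b φ k p‖ ^ 2 * p.2)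
      ≤ ENNReal.ofReal (Real.pi * ‖φ‖ ^ 2) := by
  set F : ℕ → ℝ × ℝ → ENNReal := fun N p => ENNReal.ofReal
    (‖∑ m ∈ Finset.range N, inner ℂ φ (b m) * polarElement m k p‖ ^ 2 * p.2) with hF
  have hlim : ∀ p, liminf (fun N => F N p) atTop
      = ENNReal.ofReal (‖amplitude b φ k p‖ ^ 2 * p.2) := by
    intro p
    refine Tendsto.liminf_eq ?_
    exact (ENNReal.continuous_ofReal.tendsto _).comp
      (((hasSum_amplitude b φ k p).tendsto_sum_nat.norm.pow 2).mul_const _)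
  have hmeas : ∀ N, Measurable (F N) := by
    intro N
    have : Continuous fun p : ℝ × ℝ =>
        ∑ m ∈ Finset.range N, inner ℂ φ (b m) * polarElement m k p :=
      continuous_finsetSum _ fun m _ => continuous_const.mul (continuous_polarElement m k)
    exact (ENNReal.continuous_ofReal.comp ((this.norm.pow 2).mul continuous_snd)).measurable
  simp only [← hlim]
  -- Fatou along the partial sums in the number basis; Bessel's inequality bounds their integrals
  -- uniformly.
  refine (lintegral_liminf_le hmeas).trans ?_
  refine liminf_le_of_le (by isBoundedDefault) fun c hc => ?_
  obtain ⟨N, hN⟩ := hc.exists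
  refine hN.trans ?_
  rw [hF, lintegral_sum_polarElement]
  refine ENNReal.ofReal_le_ofReal ?_
  gcongr
  have := b.orthonormal.sum_inner_products_le φ (s := Finset.range N)
  simpa only [norm_inner_symm φ] using this

/-! ### The weak integral of a diagonal state is a bounded operator -/

/-- The integrand of the phase observable in polar coordinates. -/
def phaseIntegrand (b : HilbertBasis ℕ ℂ H) (T : H →L[ℂ] H) (φ ψ : H) (p : ℝ × ℝ) : ℂ :=
  inner ℂ φ ((shift b (p.2 * Complex.exp (p.1 * Complex.I)) ∘L T ∘L
      (shift b (p.2 * Complex.exp (p.1 * Complex.I))).adjoint) ψ) * (p.2 : ℂ)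

/-- `T` is the diagonal state with the weights `l`. -/
def IsDiagonal (b : HilbertBasis ℕ ℂ H) (T : H →L[ℂ] H) (l : ℕ → ℝ) : Prop :=
  (∀ n, 0 ≤ l n) ∧ HasSum l 1 ∧
    HasSum (fun n => (l n : ℂ) • InnerProductSpace.rankOne ℂ (b n) (b n)) T

variable {b : HilbertBasis ℕ ℂ H} {T : H →L[ℂ] H} {l : ℕ → ℝ}

lemma IsDiagonal.hasSum_phaseIntegrand (h : IsDiagonal b T l) (φ ψ : H) (p : ℝ × ℝ) :
    HasSum (fun k => (l k : ℂ) * (amplitude b φ k p * conj (amplitude b ψ k p) * p.2))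
      (phaseIntegrand b T φ ψ p) := by
  set D := shift b (p.2 * Complex.exp (p.1 * Complex.I)) with hD
  have h1 := (h.2.2.mapL (ContinuousLinearMap.apply ℂ H (D.adjoint ψ))).mapL
    (innerSL ℂ φ ∘L D)
  have h2 := h1.mul_right (p.2 : ℂ)
  have e : phaseIntegrand b T φ ψ p = (innerSL ℂ φ ∘L D)
      ((ContinuousLinearMap.apply ℂ H (D.adjoint ψ)) T) * (p.2 : ℂ) := by
    simp [phaseIntegrand, hD]
  rw [e]
  refine (congrArg (HasSum · _) (funext fun k => ?_)).mp h2
  simp [amplitude, ← hD, ContinuousLinearMap.adjoint_inner_right]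
  ring

lemma IsDiagonal.measurable_phaseIntegrand (h : IsDiagonal b T l) (φ ψ : H) :
    Measurable (phaseIntegrand b T φ ψ) := by
  refine measurable_of_tendsto_metrizable
    (f := fun N p => ∑ k ∈ Finset.range N,
      (l k : ℂ) * (amplitude b φ k p * conj (amplitude b ψ k p) * p.2)) (fun N => ?_) ?_
  · refine Finset.measurable_fun_sum _ fun k _ => Measurable.const_mul ?_ _
    have h1 := measurable_amplitude b φ k
    have h2 := measurable_amplitude b ψ k
    have h3 : Measurable fun p => conj (amplitude b ψ k p) :=
      Complex.continuous_conj.measurable.comp h2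
    have h4 : Measurable fun p : ℝ × ℝ => (p.2 : ℂ) :=
      Complex.measurable_ofReal.comp measurable_snd
    exact (h1.mul h3).mul h4
  · exact tendsto_pi_nhds.2 fun p => (h.hasSum_phaseIntegrand φ ψ p).tendsto_sum_nat

/-- Bound each product of amplitudes by the sum of their squares, which integrates to a bound
independent of `k`; the weights then sum to `1`. -/
lemma IsDiagonal.lintegral_phaseIntegrand_le (h : IsDiagonal b T l) (φ ψ : H) :
    ∫⁻ p in polarStrip, ‖phaseIntegrand b T φ ψ p‖ₑ
      ≤ ENNReal.ofReal (Real.pi * (‖φ‖ ^ 2 + ‖ψ‖ ^ 2)) := by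
  set G : H → ℕ → ℝ × ℝ → ENNReal :=
    fun χ k p => ENNReal.ofReal (‖amplitude b χ k p‖ ^ 2 * p.2) with hG
  have hGm : ∀ χ k, Measurable (G χ k) := fun χ k =>
    (((measurable_amplitude b χ k).norm.pow_const 2).mul measurable_snd).ennreal_ofReal
  have h1 : ∀ p ∈ polarStrip, ‖phaseIntegrand b T φ ψ p‖ₑ
      ≤ ∑' k, ENNReal.ofReal (l k) * (G φ k p + G ψ k p) := by
    intro p hp
    have hr : 0 < p.2 := hp.2
    rw [← (h.hasSum_phaseIntegrand φ ψ p).tsum_eq]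
    refine enorm_tsum_le_tsum_enorm.trans (ENNReal.tsum_le_tsum fun k => ?_)
    rw [hG]
    simp only
    rw [← ENNReal.ofReal_add (by positivity) (by positivity), ← ENNReal.ofReal_mul (h.1 k),
      ← ofReal_norm]
    refine ENNReal.ofReal_le_ofReal ?_
    rw [norm_mul, norm_mul, norm_mul, Complex.norm_real, Complex.norm_real, RCLike.norm_conj,
      Real.norm_of_nonneg (h.1 k), Real.norm_of_nonneg hr.le, ← add_mul]
    refine mul_le_mul_of_nonneg_left (mul_le_mul_of_nonneg_right ?_ hr.le) (h.1 k)
    nlinarith [sq_nonneg (‖amplitude b φ k p‖ - ‖amplitude b ψ k p‖),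
      sq_nonneg ‖amplitude b φ k p‖, sq_nonneg ‖amplitude b ψ k p‖]
  refine (setLIntegral_mono' measurableSet_polarStrip h1).trans ?_
  rw [lintegral_tsum (f := fun k p => ENNReal.ofReal (l k) * (G φ k p + G ψ k p)) fun k => (((hGm φ k).add (hGm ψ k)).const_mul _).aemeasurable]
  have h2 : ∀ k, ∫⁻ p in polarStrip, ENNReal.ofReal (l k) * (G φ k p + G ψ k p)
      ≤ ENNReal.ofReal (l k) * ENNReal.ofReal (Real.pi * (‖φ‖ ^ 2 + ‖ψ‖ ^ 2)) := by
    intro k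
    rw [lintegral_const_mul' _ _ ENNReal.ofReal_ne_top, lintegral_add_left (hGm φ k), mul_add Real.pi,
      ENNReal.ofReal_add (by positivity) (by positivity)]
    gcongr
    · exact lintegral_amplitude_sq_le b φ k
    · exact lintegral_amplitude_sq_le b ψ k
  refine (ENNReal.tsum_le_tsum h2).trans ?_
  rw [ENNReal.tsum_mul_right, ← ENNReal.ofReal_tsum_of_nonneg h.1 h.2.1.summable, h.2.1.tsum_eq,
    ENNReal.ofReal_one, one_mul]

lemma IsDiagonal.integrableOn_phaseIntegrand (h : IsDiagonal b T l) (φ ψ : H) :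
    IntegrableOn (phaseIntegrand b T φ ψ) polarStrip :=
  ⟨(h.measurable_phaseIntegrand φ ψ).aestronglyMeasurable,
    (h.lintegral_phaseIntegrand_le φ ψ).trans_lt ENNReal.ofReal_lt_top⟩

lemma args_prod_subset (X : Set Circle) : args X ×ˢ Set.Ioi (0 : ℝ) ⊆ polarStrip :=
  Set.prod_mono (fun _ h => h.1) subset_rfl

lemma IsDiagonal.phaseForm_eq (h : IsDiagonal b T l) (X : Set Circle) (φ ψ : H) :
    phaseForm b T X φ ψ
      = (1 / Real.pi : ℂ) * ∫ p in args X ×ˢ Set.Ioi 0, phaseIntegrand b T φ ψ p := by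
  have hi := (h.integrableOn_phaseIntegrand φ ψ).mono_set (args_prod_subset X)
  rw [IntegrableOn, volume_restrict_prod] at hi
  rw [volume_restrict_prod, integral_prod _ hi]
  rfl

lemma IsDiagonal.norm_phaseForm_le (h : IsDiagonal b T l) (X : Set Circle) (φ ψ : H) :
    ‖phaseForm b T X φ ψ‖ ≤ ‖φ‖ ^ 2 + ‖ψ‖ ^ 2 := by
  have h1 : ‖∫ p in args X ×ˢ Set.Ioi 0, phaseIntegrand b T φ ψ p‖
      ≤ Real.pi * (‖φ‖ ^ 2 + ‖ψ‖ ^ 2) := by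
    rw [← ENNReal.ofReal_le_ofReal_iff (by positivity), ofReal_norm]
    exact (enorm_integral_le_lintegral_enorm _).trans
      ((lintegral_mono_set (args_prod_subset X)).trans (h.lintegral_phaseIntegrand_le φ ψ))
  rw [h.phaseForm_eq, norm_mul, norm_div, norm_one, Complex.norm_real,
    Real.norm_of_nonneg Real.pi_pos.le, one_div, inv_mul_le_iff₀ Real.pi_pos]
  exact h1

/-- The sesquilinear form of the phase observable of a diagonal state. -/
def IsDiagonal.phaseSesq (h : IsDiagonal b T l) (X : Set Circle) : H →ₗ⋆[ℂ] H →ₗ[ℂ] ℂ :=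
  have hi := fun φ ψ => (h.integrableOn_phaseIntegrand φ ψ).mono_set (args_prod_subset X)
  LinearMap.mk₂'ₛₗ (starRingEnd ℂ) (RingHom.id ℂ) (phaseForm b T X)
    (fun φ₁ φ₂ ψ => by
      rw [h.phaseForm_eq, h.phaseForm_eq, h.phaseForm_eq, ← mul_add,
        ← integral_add (hi φ₁ ψ) (hi φ₂ ψ)]
      simp only [phaseIntegrand, inner_add_left, add_mul])
    (fun c φ ψ => by
      rw [h.phaseForm_eq, h.phaseForm_eq, smul_eq_mul, mul_left_comm]
      congr 1
      rw [← integral_const_mul]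
      simp only [phaseIntegrand, inner_smul_left, mul_assoc])
    (fun φ ψ₁ ψ₂ => by
      rw [h.phaseForm_eq, h.phaseForm_eq, h.phaseForm_eq, ← mul_add,
        ← integral_add (hi φ ψ₁) (hi φ ψ₂)]
      simp only [phaseIntegrand, map_add, inner_add_right, add_mul])
    (fun c φ ψ => by
      rw [h.phaseForm_eq, h.phaseForm_eq, smul_eq_mul, mul_left_comm]
      congr 1
      rw [← integral_const_mul]
      simp only [phaseIntegrand, map_smul, inner_smul_right, mul_assoc, RingHom.id_apply])

/-- Normalising both vectors turns the bound by `‖φ‖² + ‖ψ‖²` into a product bound; the constant is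
`1² + 1²`. -/
lemma IsDiagonal.norm_phaseSesq_le (h : IsDiagonal b T l) (X : Set Circle) (φ ψ : H) :
    ‖h.phaseSesq X φ ψ‖ ≤ 2 * ‖φ‖ * ‖ψ‖ := by
  by_cases hφ : φ = 0
  · simp [hφ]
  by_cases hψ : ψ = 0
  · simp [hψ]
  have hφ' : 0 < ‖φ‖ := norm_pos_iff.2 hφ
  have hψ' : 0 < ‖ψ‖ := norm_pos_iff.2 hψ
  have h1 : ‖h.phaseSesq X (((‖φ‖⁻¹ : ℝ) : ℂ) • φ) (((‖ψ‖⁻¹ : ℝ) : ℂ) • ψ)‖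
      ≤ ‖((‖φ‖⁻¹ : ℝ) : ℂ) • φ‖ ^ 2 + ‖((‖ψ‖⁻¹ : ℝ) : ℂ) • ψ‖ ^ 2 := h.norm_phaseForm_le X _ _
  simp only [LinearMap.map_smulₛₗ, LinearMap.smul_apply, map_smul, norm_smul, RCLike.norm_conj,
    Complex.norm_real, norm_inv, norm_norm, inv_mul_cancel₀ hφ'.ne', inv_mul_cancel₀ hψ'.ne'] at h1
  have h2 : ‖h.phaseSesq X φ ψ‖
      = ‖φ‖ * ‖ψ‖ * (‖ψ‖⁻¹ * (‖φ‖⁻¹ * ‖h.phaseSesq X φ ψ‖)) := by field_simp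
  rw [h2]
  calc _ ≤ ‖φ‖ * ‖ψ‖ * (1 ^ 2 + 1 ^ 2) := by gcongr
    _ = _ := by ring

/-- The phase observable of a diagonal state represents the defining sesquilinear form. -/
lemma IsDiagonal.inner_phaseObservable (h : IsDiagonal b T l) (X : Set Circle) (φ ψ : H) :
    inner ℂ φ (phaseObservable b T X ψ) = phaseForm b T X φ ψ := by
  -- This excludes the default value `0` of `phaseObservable`. The adjoint appears because the
  -- operator attached to a bounded form acts in the first slot.
  have hex : ∃ E : H →L[ℂ] H, ∀ φ ψ : H, inner ℂ φ (E ψ) = phaseForm b T X φ ψ := by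
    refine ⟨(InnerProductSpace.continuousLinearMapOfBilin
      ((h.phaseSesq X).mkContinuous₂ 2 (h.norm_phaseSesq_le X))).adjoint, fun φ ψ => ?_⟩
    rw [ContinuousLinearMap.adjoint_inner_right,
      InnerProductSpace.continuousLinearMapOfBilin_apply]
    rfl
  rw [phaseObservable, dif_pos hex]
  exact hex.choose_spec φ ψ

/-! ### The matrix elements between `|0⟩` and `|2(d+1)⟩` -/

lemma integral_norm_radial_mul_radial_le (m n k : ℕ) :
    ∫ r in Set.Ioi (0 : ℝ), ‖radial m k r * radial n k r * r‖ ≤ 1 := by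
  have hm := integrableOn_radial_mul_radial m m k
  have hn := integrableOn_radial_mul_radial n n k
  calc ∫ r in Set.Ioi (0 : ℝ), ‖radial m k r * radial n k r * r‖
      ≤ ∫ r in Set.Ioi (0 : ℝ), (radial m k r * radial m k r * r
        + radial n k r * radial n k r * r) := by
        refine setIntegral_mono_on (integrableOn_radial_mul_radial m n k).norm (hm.add hn)
          measurableSet_Ioi fun r hr => ?_
        have hr' : (0 : ℝ) < r := hr
        rw [norm_mul, Real.norm_of_nonneg hr'.le, ← add_mul]
        refine mul_le_mul_of_nonneg_right ?_ hr'.le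
        rw [Real.norm_eq_abs, abs_le]
        constructor <;> nlinarith [sq_nonneg (radial m k r - radial n k r),
          sq_nonneg (radial m k r + radial n k r)]
    _ = 1 := by
        rw [integral_add hm hn, integral_radial_sq, integral_radial_sq]
        norm_num

/-- Sum over `k` and integral over `r` may be exchanged, and the vanishing of `C(d,k)` for `k > d`
leaves a finite sum. The angle survives only in the phase in front. -/
lemma IsDiagonal.integral_phaseIntegrand_radial (h : IsDiagonal b T l) (d : ℕ) (θ : ℝ) :
    ∫ r in Set.Ioi (0 : ℝ), phaseIntegrand b T (b 0) (b (2 * (d + 1))) (θ, r)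
      = Complex.exp (((0 : ℕ) - (2 * (d + 1) : ℕ)) * θ * Complex.I) *
        (((d + 1).factorial / (2 * Real.sqrt (2 * (d + 1)).factorial)
          * ∑ k ∈ Finset.range (d + 1), l k * ((-1) ^ k * (d.choose k : ℝ)) : ℝ) : ℂ) := by
  set n := 2 * (d + 1) with hn
  set u := Complex.exp (((0 : ℕ) - (n : ℕ)) * θ * Complex.I) with hu
  have hu1 : ‖u‖ = 1 := by
    have : (((0 : ℕ) - (n : ℕ)) * θ * Complex.I : ℂ) = ((-(n * θ) : ℝ) : ℂ) * Complex.I := by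
      push_cast; ring
    rw [hu, this, Complex.norm_exp_ofReal_mul_I]
  set F : ℕ → ℝ → ℂ := fun k r =>
    (l k : ℂ) * (u * ((radial 0 k r * radial n k r * r : ℝ) : ℂ)) with hF
  have h1 : ∀ r, ∑' k, F k r = phaseIntegrand b T (b 0) (b n) (θ, r) := by
    intro r
    have := h.hasSum_phaseIntegrand (b 0) (b n) (θ, r)
    simp only [amplitude_basis] at this
    rw [← this.tsum_eq]
    exact tsum_congr fun k => congrArg ((l k : ℂ) * ·) (polarElement_mul_conj 0 n k (θ, r)).symm
  have hint : ∀ k, Integrable (F k) (volume.restrict (Set.Ioi 0)) := fun k =>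
    ((Integrable.ofReal (integrableOn_radial_mul_radial 0 n k)).const_mul _).const_mul _
  -- The phase has modulus one and the radial integrals are at most `1`, so the weights dominate.
  have hsum : Summable fun k => ∫ r in Set.Ioi (0 : ℝ), ‖F k r‖ := by
    refine Summable.of_nonneg_of_le (fun k => integral_nonneg fun r => norm_nonneg _)
      (fun k => ?_) h.2.1.summable
    simp only [hF, norm_mul u, hu1, one_mul, norm_mul (l k : ℂ), Complex.norm_real,
      Real.norm_of_nonneg (h.1 k)]
    rw [integral_const_mul]
    exact mul_le_of_le_one_right (h.1 k) (integral_norm_radial_mul_radial_le 0 n k)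
  have h2 := hasSum_integral_of_summable_integral_norm hint hsum
  simp only [h1] at h2
  have h3 : ∀ k, ∫ r in Set.Ioi (0 : ℝ), F k r = u * (((d + 1).factorial /
      (2 * Real.sqrt n.factorial) * (l k * ((-1) ^ k * (d.choose k : ℝ))) : ℝ) : ℂ) := by
    intro k
    simp only [hF]
    rw [integral_const_mul, integral_const_mul, integral_complex_ofReal,
      integral_radial_zero_mul_radial]
    push_cast
    ring
  simp only [h3] at h2
  refine h2.unique ?_
  rw [Finset.mul_sum, Complex.ofReal_sum, Finset.mul_sum]
  refine hasSum_sum_of_ne_finset_zero fun k hk => ?_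
  rw [Finset.mem_range, not_lt] at hk
  rw [Nat.choose_eq_zero_of_lt hk]
  simp

lemma IsDiagonal.phaseForm_basis (h : IsDiagonal b T l) (X : Set Circle) (d : ℕ) :
    phaseForm b T X (b 0) (b (2 * (d + 1)))
      = (1 / Real.pi : ℂ) * ((∫ θ in args X,
          Complex.exp (((0 : ℕ) - (2 * (d + 1) : ℕ)) * θ * Complex.I)) *
        (((d + 1).factorial / (2 * Real.sqrt (2 * (d + 1)).factorial)
          * ∑ k ∈ Finset.range (d + 1), l k * ((-1) ^ k * (d.choose k : ℝ)) : ℝ) : ℂ)) := by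
  rw [← integral_mul_const]
  simp only [← h.integral_phaseIntegrand_radial]
  rfl

/-! ### Test arcs and recovery of the weights -/

lemma args_image_Icc {a : ℝ} (ha : a < 2 * Real.pi) :
    args (Circle.exp '' Set.Icc 0 a) = Set.Icc 0 a := by
  ext θ
  constructor
  · rintro ⟨h1, t, ht, h2⟩
    have : t = θ := Circle.exp_injOn_Ico (by simp) ⟨ht.1, ht.2.trans_lt ha⟩ h1 h2
    exact this ▸ ht
  · intro h
    exact ⟨⟨h.1, h.2.trans_lt ha⟩, θ, h, rfl⟩

/-- The length `π/n` is half a period of `e^{-inθ}`: the primitive changes sign between the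
endpoints, whereas a full period would give zero. -/
lemma integral_exp_arc_ne_zero {n : ℕ} (hn : 0 < n) :
    ∫ θ in Set.Icc 0 (Real.pi / n), Complex.exp (((0 : ℕ) - (n : ℕ)) * θ * Complex.I) ≠ 0 := by
  have hn' : (n : ℂ) ≠ 0 := by exact_mod_cast hn.ne'
  rw [integral_Icc_eq_integral_Ioc, ← intervalIntegral.integral_of_le (by positivity)]
  have hc : (((0 : ℕ) : ℂ) - (n : ℕ)) * Complex.I ≠ 0 := by
    simpa using hn'
  have h2 := integral_exp_mul_complex (a := 0) (b := Real.pi / n) hc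
  simp only [mul_right_comm _ Complex.I] at h2
  have h3 : (((0 : ℕ) : ℂ) - (n : ℕ)) * ((Real.pi / n : ℝ) : ℂ) * Complex.I
      = -(Real.pi * Complex.I) := by
    push_cast
    field_simp
    ring
  rw [h2, h3, Complex.exp_neg, Complex.exp_pi_mul_I]
  refine div_ne_zero ?_ hc
  norm_num

/-- The binomial transform is injective. -/
lemma eq_of_binomial_transform_eq {l l' : ℕ → ℝ}
    (h : ∀ d, ∑ k ∈ Finset.range (d + 1), l k * ((-1) ^ k * (d.choose k : ℝ))
      = ∑ k ∈ Finset.range (d + 1), l' k * ((-1) ^ k * (d.choose k : ℝ))) : l = l' := by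
  funext d
  induction d using Nat.strong_induction_on with
  | _ d ih =>
    -- The earlier weights agree by induction, so only `k = d` is left, with coefficient `(-1)^d`.
    have hd := h d
    rw [Finset.sum_range_succ, Finset.sum_range_succ, Finset.sum_congr rfl fun k hk => by
      rw [ih k (Finset.mem_range.1 hk)], add_right_inj] at hd
    refine mul_right_cancel₀ ?_ hd
    simp

/-- For each `d` a single compact arc suffices, so agreement of the observables on closed sets is
enough. -/
lemma IsDiagonal.weights_eq {T' : H →L[ℂ] H} {l' : ℕ → ℝ} (h : IsDiagonal b T l)
    (h' : IsDiagonal b T' l')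
    (hE : ∀ X : Set Circle, IsClosed X → phaseObservable b T X = phaseObservable b T' X) :
    l = l' := by
  refine eq_of_binomial_transform_eq fun d => ?_
  set n := 2 * (d + 1) with hn
  have hn0 : 0 < n := by omega
  set X := Circle.exp '' Set.Icc 0 (Real.pi / n) with hX
  have hcl : IsClosed X := (isCompact_Icc.image Circle.exp.continuous).isClosed
  have harg : args X = Set.Icc 0 (Real.pi / n) := by
    refine args_image_Icc ?_
    have : Real.pi / n ≤ Real.pi := div_le_self Real.pi_pos.le (by exact_mod_cast hn0)
    linarith [Real.pi_pos]
  have h1 : phaseForm b T X (b 0) (b n) = phaseForm b T' X (b 0) (b n) := by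
    rw [← h.inner_phaseObservable, ← h'.inner_phaseObservable, hE X hcl]
  rw [h.phaseForm_basis, h'.phaseForm_basis, harg] at h1
  have hpi : (1 / Real.pi : ℂ) ≠ 0 := by simp [Real.pi_ne_zero]
  have h2 := mul_left_cancel₀ (integral_exp_arc_ne_zero hn0) (mul_left_cancel₀ hpi h1)
  have h3 : Real.sqrt n.factorial ≠ 0 := (Real.sqrt_pos.2 (by positivity)).ne'
  exact mul_left_cancel₀ (by positivity) (Complex.ofReal_injective h2)

end

end PhaseSpace

theorem mainTheorem8 {H : Type*} [NormedAddCommGroup H] [InnerProductSpace ℂ H] [CompleteSpace H]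
    (b : HilbertBasis ℕ ℂ H) (T T' : H →L[ℂ] H)
    (hT : T ∈ PhaseSpace.diagonalStates b) (hT' : T' ∈ PhaseSpace.diagonalStates b)
    (hE : ∀ X : Set Circle, @MeasurableSet Circle (borel Circle) X →
      PhaseSpace.phaseObservable b T X = PhaseSpace.phaseObservable b T' X) :
    T = T' := by
  obtain ⟨l, hl⟩ := hT
  obtain ⟨l', hl'⟩ := hT'
  have h : l = l' := PhaseSpace.IsDiagonal.weights_eq hl hl' fun X hX => hE X <| by
    borelize Circle
    exact hX.measurableSet
  subst h
  exact hl.2.2.unique hl'.2.2
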